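/- Consider one-pass streaming algorithms that receive the edges of a simple undirected (unweighted) graph $G$ on a known vertex set of $n\ge 2$ vertices, each edge exactly once and in an arbitrary (adversarial) order, and that then output a real number. Let $\lambda(G)$ be the minimum cut value of $G$, i.e. the minimum over all vertex sets $\varnothing\neq S\subsetneq V$ of the number of edges between $S$ and $V\setminus S$. A number $a$ is a $(1+\varepsilon)$-approximation to $\lambda(G)$ if $(1-\varepsilon)\lambda(G)\le a\le(1+\varepsilon)\lambda(G)$. An algorithm uses $s$ bits of space if its memory content between any two arrivals is an element of $\{0,1\}^s$; its computations are otherwise unrestricted (they may depend on $n$, $\varepsilon$ and the position in the stream), and the random bits of a randomized algorithm are not counted as space. **Theorem.** There is an absolute constant $c>0$ such that the following holds for every integer $n\ge 2$. 1. (Randomized.) Let $1/n<\varepsilon<1$. If a randomized one-pass streaming algorithm with $s$ bits of space outputs, for every simple undirected graph $G$ on $n$ vertices and every order of its edges, a $(1+\varepsilon)$-approximation to $\lambda(G)$ with probability at least $2/3$, then $s\ge c\,n/\varepsilon$. 2. (Deterministic.) Let $n^{-1/4}\le\varepsilon<1$. If a deterministic one-pass streaming algorithm with $s$ bits of space outputs,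 for every simple undirected graph $G$ on $n$ vertices and every order of its edges, a $(1+\varepsilon)$-approximation to $\lambda(G)$, then $s\ge c\,n/\varepsilon^2$. -/

import Mathlib

open MeasureTheory

/-- The edges of `G` with one endpoint in `S` and the other one outside `S`. -/
def cutEdges {V : Type*} (G : SimpleGraph V) (S : Set V) : Set (Sym2 V) :=
  {e | e ∈ G.edgeSet ∧ ∃ u ∈ S, ∃ v ∈ Sᶜ, e = s(u, v)}

/-- The minimum cut value of `G`: the least number of edges between `S` and its complement, over
all `S` with `∅ ≠ S ≠ V`. (On at least two vertices such `S` exist.) -/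
noncomputable def minCutValue {V : Type*} (G : SimpleGraph V) : ℕ :=
  sInf {k | ∃ S : Set V, S.Nonempty ∧ Sᶜ.Nonempty ∧ (cutEdges G S).ncard = k}

/-- `a` is a `(1 + ε)`-approximation of `b`: `(1 - ε) b ≤ a ≤ (1 + ε) b`. -/
def IsApprox (ε a b : ℝ) : Prop :=
  (1 - ε) * b ≤ a ∧ a ≤ (1 + ε) * b

/-- `l` is an insertion-only stream of the simple graph `G`: every edge of `G` occurs in `l`
exactly once, in any order. -/
def IsEdgeStream {V : Type*} (G : SimpleGraph V) (l : List (Sym2 V)) : Prop :=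
  l.Nodup ∧ ∀ e, e ∈ l ↔ e ∈ G.edgeSet

/-- A (non-uniform, deterministic) one-pass streaming algorithm with `s` bits of memory, reading a
stream of items of type `α` and returning an element of `β`. There is no restriction on the
computations that it performs. `update t m a` is the new memory content when item number `t` of
the stream (counted from `0`) is `a` and the memory content is `m`. The position `t` is available
for free, which only allows more algorithms; in particular, a random family of such algorithms may
use fresh random bits at every step. -/
structure StreamingAlgorithm (α β : Type*) (s : ℕ) where
  init : Fin s → Bool
  update : ℕ → (Fin s → Bool) → α → (Fin s → Bool)
  output : (Fin s → Bool) → β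

namespace StreamingAlgorithm

variable {α β : Type*} {s : ℕ}

/-- The memory content after reading the list, starting at position `t` with memory content `m`. -/
def process (A : StreamingAlgorithm α β s) : ℕ → (Fin s → Bool) → List α → (Fin s → Bool)
  | _, m, [] => m
  | t, m, a :: l => process A (t + 1) (A.update t m a) l

/-- The value returned after one pass over the stream `l`. -/
def run (A : StreamingAlgorithm α β s) (l : List α) : β :=
  A.output (A.process 0 A.init l)

end StreamingAlgorithm

/-- The deterministic algorithm `A` returns a `(1 + ε)`-approximation to the minimum cut value of
every simple graph on `n` vertices, for every order of arrival of the edges. -/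
def ApproximatesMinCut {n s : ℕ} (ε : ℝ)
    (A : StreamingAlgorithm (Sym2 (Fin n)) ℝ s) : Prop :=
  ∀ (G : SimpleGraph (Fin n)) (l : List (Sym2 (Fin n))), IsEdgeStream G l →
    IsApprox ε (A.run l) (minCutValue G)

/-- A randomized algorithm with `s` bits of memory is a family `A` of algorithms indexed by a random
seed `ω` with law `P` (the seed, a source of unlimited randomness, is not charged as memory).
For every simple graph on `n` vertices and every order of arrival of its edges, its output
is a random variable that is a `(1 + ε)`-approximation to the minimum cut value with
probability at least `p`. -/
def RandomizedApproximatesMinCut {n s : ℕ} {Ω : Type*} [MeasurableSpace Ω] (P : Measure Ω)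
    (ε p : ℝ) (A : Ω → StreamingAlgorithm (Sym2 (Fin n)) ℝ s) : Prop :=
  ∀ (G : SimpleGraph (Fin n)) (l : List (Sym2 (Fin n))), IsEdgeStream G l →
    (Measurable fun ω => (A ω).run l) ∧
      p ≤ P.real {ω | IsApprox ε ((A ω).run l) (minCutValue G)}

/-! Both bounds are one-way communication arguments: the first part of the stream encodes a bit
string `x`, the rest asks a question about `x`, and the memory content in between is the message.

The string has `B * k * k` bits and chooses a two-fold cover of `B` disjoint copies of the complete
bipartite graph with sides of size `k`: bit `(b, i, j)` says whether the two lifts of edge `ij` stay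
in their layers or cross. All degrees are `k`, whatever `x` is. So the set of lifts of `A` and `A'`
in layer `false` of copy `b` has cut value `k (|A| + |A'|)` minus twice the number of bits `false`
in `A × A'` (`ncard_cutEdges_liftGraph`). The second part of the stream adds hubs: vertices on the
same side get many common neighbours, so this cut becomes minimum without changing its value
(`minCutValue_sup_hubGraph`).

Randomized: for singletons the value is `2k` or `2k - 2`, which a `(1 + ε)`-approximation tells
apart when `(2k - 1) ε < 1`. Each bit is recovered with probability `2/3`. With `k ~ 1/ε` and `B ~
n/k` there are about `nk ~ n/ε` bits.

Deterministic: all queries are answered correctly at once. If `x` and `y` give the same memory and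
differ in a third of the bits, then in some copy a Khintchine argument (`exists_submatrix_sum_ge`)
gives `A, A'` whose counts differ by order `k^(3/2)`. This exceeds the tolerated error, of order `ε
k²`, when `ε √k` is small. So `k ~ 1/ε²` is allowed, giving about `n/ε²` bits. The order `k²` hubs
must fit, hence `ε ≥ n^(-1/4)`.

In both cases the memory determines `x` up to a third of its bits on average, and `card_le_of_agree`
bounds `s`. -/

/-! ### Recovering most bits of a string from a short message -/

theorem sum_two_pow_card_agree {P : Type*} [Fintype P] [DecidableEq P] (g : P → Bool) :
    ∑ x : P → Bool, (2 : ℝ) ^ (Finset.univ.filter fun p => g p = x p).card =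
      3 ^ Fintype.card P := by
  -- The weight is a product over coordinates, so the sum factors, with `2 + 1` from each.
  have h : ∀ x : P → Bool, (2 : ℝ) ^ (Finset.univ.filter fun p => g p = x p).card =
      ∏ p, if g p = x p then 2 else 1 := by
    intro x
    rw [Finset.prod_ite]
    simp
  simp_rw [h]
  rw [← Fintype.piFinset_univ,
    ← Finset.prod_univ_sum (fun _ => Finset.univ) (fun p b => if g p = b then (2 : ℝ) else 1)]
  have h3 : ∀ p, ∑ b : Bool, (if g p = b then (2 : ℝ) else 1) = 3 := by
    intro p
    cases g p <;> norm_num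
  rw [Finset.prod_congr rfl fun p _ => h3 p, Finset.prod_const, Finset.card_univ]

/-- If `s` bits of information on a bit string `x` allow one to recover two thirds of the bits
of `x` on average, then `s` is at least a constant fraction of the length of `x`. -/
theorem card_le_of_agree {P : Type*} [Fintype P] [DecidableEq P] {s : ℕ}
    (f : (P → Bool) → (Fin s → Bool)) (g : (Fin s → Bool) → P → Bool)
    (h : 2 / 3 * Fintype.card P * 2 ^ Fintype.card P ≤
      ∑ x : P → Bool, ((Finset.univ.filter fun p => g (f x) p = x p).card : ℝ)) :
    Fintype.card P ≤ 13 * s := by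
  set N := Fintype.card P with hN
  set a : (P → Bool) → ℕ := fun x => (Finset.univ.filter fun p => g (f x) p = x p).card with ha
  have h1 : ∑ x, (2 : ℝ) ^ a x ≤ 2 ^ s * 3 ^ N := by
    calc ∑ x, (2 : ℝ) ^ a x
        ≤ ∑ x : P → Bool, ∑ m : Fin s → Bool, (2 : ℝ) ^ (Finset.univ.filter fun p => g m p = x p).card := by
          refine Finset.sum_le_sum fun x _ => ?_
          exact Finset.single_le_sum
            (f := fun m => (2 : ℝ) ^ (Finset.univ.filter fun p => g m p = x p).card)
            (fun _ _ => by positivity) (Finset.mem_univ (f x))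
      _ = 2 ^ s * 3 ^ N := by
          rw [Finset.sum_comm]
          simp [sum_two_pow_card_agree, hN]
  -- Jensen's inequality, by the tangent to `2 ^ a` at `a = 2N/3`; the left side is `2 ^ (2N/3) * 2
  -- ^ N`.
  have h2 : Real.exp (Real.log 2 * (2 / 3 * N)) * 2 ^ N ≤ ∑ x, (2 : ℝ) ^ a x := by
    have tangent : ∀ x, Real.exp (Real.log 2 * (2 / 3 * N)) *
        (Real.log 2 * (a x - 2 / 3 * N) + 1) ≤ (2 : ℝ) ^ a x := by
      intro x
      have e : (2 : ℝ) ^ a x = Real.exp (Real.log 2 * (2 / 3 * N)) *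
          Real.exp (Real.log 2 * (a x - 2 / 3 * N)) := by
        rw [← Real.exp_add, ← Real.rpow_natCast, Real.rpow_def_of_pos (by norm_num)]
        ring_nf
      rw [e]
      exact mul_le_mul_of_nonneg_left (Real.add_one_le_exp _) (Real.exp_pos _).le
    refine le_trans ?_ (Finset.sum_le_sum fun x _ => tangent x)
    rw [← Finset.mul_sum]
    refine mul_le_mul_of_nonneg_left ?_ (Real.exp_pos _).le
    rw [Finset.sum_add_distrib, ← Finset.mul_sum, Finset.sum_sub_distrib]
    simp only [Finset.sum_const, Finset.card_univ, Fintype.card_fun, Fintype.card_bool,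
      nsmul_eq_mul, ← hN]
    push_cast
    have := mul_nonneg (Real.log_nonneg (by norm_num : (1 : ℝ) ≤ 2)) (sub_nonneg.2 h)
    linarith
  have h3 : (32 : ℝ) ^ N ≤ 8 ^ s * 27 ^ N := by
    have e : Real.exp (Real.log 2 * (2 / 3 * N)) ^ 3 = 4 ^ N := by
      rw [← Real.exp_nat_mul,
        show ((3 : ℕ) : ℝ) * (Real.log 2 * (2 / 3 * N)) = N * (2 * Real.log 2) by push_cast; ring,
        Real.exp_nat_mul, two_mul, Real.exp_add, Real.exp_log (by norm_num)]
      norm_num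
    have h4 := pow_le_pow_left₀ (by positivity) (h2.trans h1) 3
    rw [mul_pow, mul_pow, e, ← pow_mul, ← pow_mul, ← pow_mul, mul_comm N, mul_comm s,
      pow_mul, pow_mul, pow_mul, ← mul_pow] at h4
    norm_num at h4
    exact h4
  by_contra! hlt
  have h5 : (32 / 27 : ℝ) ^ N ≤ 8 ^ s := by
    rw [div_pow, div_le_iff₀ (by positivity)]
    exact h3
  -- The constant `13` comes from `8 ≤ (32/27) ^ 13`.
  have h6 : (8 : ℝ) ^ s ≤ (32 / 27 : ℝ) ^ (13 * s) := by
    rw [pow_mul]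
    exact pow_le_pow_left₀ (by norm_num) (by norm_num) s
  have h7 : (32 / 27 : ℝ) ^ (13 * s) < (32 / 27 : ℝ) ^ N :=
    pow_lt_pow_right₀ (by norm_num) hlt
  linarith

/-! ### Random signs and submatrices of large sum -/

/-- The sign `1` or `-1` that corresponds to a bit. -/
def boolSign (b : Bool) : ℝ := if b then 1 else -1

theorem sum_fin_succ_bool (n : ℕ) (f : (Fin (n + 1) → Bool) → ℝ) :
    ∑ u, f u = ∑ u : Fin n → Bool, (f (Fin.cons true u) + f (Fin.cons false u)) := by
  rw [← (Fin.consEquiv fun _ : Fin (n + 1) => Bool).sum_comp, Fintype.sum_prod_type]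
  simp [Finset.sum_add_distrib, Fin.consEquiv]

theorem sum_signed_sq (n : ℕ) (a : Fin n → ℝ) :
    ∑ u : Fin n → Bool, (∑ j, a j * boolSign (u j)) ^ 2 = 2 ^ n * ∑ j, a j ^ 2 := by
  induction n with
  | zero => simp
  | succ n ih =>
    rw [sum_fin_succ_bool]
    simp only [Fin.sum_univ_succ, Fin.cons_zero, Fin.cons_succ, boolSign, if_true]
    have e : ∀ y : ℝ, (a 0 * 1 + y) ^ 2 + (a 0 * (if false = true then 1 else -1) + y) ^ 2 =
        2 * a 0 ^ 2 + 2 * y ^ 2 := by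
      intro y
      norm_num
      ring
    simp only [e, Finset.sum_add_distrib, ← Finset.mul_sum]
    have := ih fun j => a j.succ
    simp only [boolSign] at this
    rw [this]
    simp
    ring

theorem sum_signed_pow_four_le (n : ℕ) (a : Fin n → ℝ) :
    ∑ u : Fin n → Bool, (∑ j, a j * boolSign (u j)) ^ 4 ≤ 2 ^ n * (3 * (∑ j, a j ^ 2) ^ 2) := by
  induction n with
  | zero => simp
  | succ n ih =>
    rw [sum_fin_succ_bool]
    have h2 := sum_signed_sq n fun j => a j.succ
    have h4 := ih fun j => a j.succ
    simp only [Fin.sum_univ_succ, Fin.cons_zero, Fin.cons_succ]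
    have e : ∀ y : ℝ, (a 0 * boolSign true + y) ^ 4 + (a 0 * boolSign false + y) ^ 4 =
        2 * a 0 ^ 4 + (12 * a 0 ^ 2) * y ^ 2 + 2 * y ^ 4 := by
      intro y
      norm_num [boolSign]
      ring
    simp only [e, Finset.sum_add_distrib, ← Finset.mul_sum]
    rw [h2]
    simp only [Finset.sum_const, Finset.card_univ, Fintype.card_fun, Fintype.card_bool,
      Fintype.card_fin, nsmul_eq_mul]
    push_cast
    have : 0 ≤ (2 : ℝ) ^ n * a 0 ^ 4 := by positivity
    rw [pow_succ (2 : ℝ) n]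
    linarith

/-- For a matrix with entries of absolute value at most `1` and with `R` the sum of the squares of
its entries, some choice of column signs makes the row sums large. -/
theorem exists_signs_sum_abs_ge {k : ℕ} (hk : 0 < k) (D : Fin k → Fin k → ℝ)
    (hD : ∀ i j, D i j ^ 2 ≤ 1) :
    ∃ u : Fin k → Bool, 5 / 9 * ∑ i, ∑ j, D i j ^ 2 ≤
      √k * ∑ i, |∑ j, D i j * boolSign (u j)| := by
  have hk' : (0 : ℝ) < k := by exact_mod_cast hk
  set t := √(k : ℝ) with ht
  have ht0 : 0 < t := Real.sqrt_pos.2 hk'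
  have htk : t ^ 2 = k := Real.sq_sqrt hk'.le
  -- A minorant of `√k |x|` by second and fourth powers, touching at `|x| = 3√k/2`. On averaging, a
  -- row with sum of squares `r ≤ k` loses at most `4/27 * 3r`, which leaves `5/9 * r`.
  have key : ∀ x : ℝ, x ^ 2 - 4 / 27 * (x ^ 4 / k) ≤ t * |x| := by
    intro x
    rw [← htk, ← sq_abs, show x ^ 4 = |x| ^ 4 by rw [← abs_pow, abs_of_nonneg (by positivity)]]
    set y := |x|
    have hy : 0 ≤ y := abs_nonneg x
    have : t * y - (y ^ 2 - 4 / 27 * (y ^ 4 / t ^ 2)) =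
        y * (y + 3 * t) * (2 * y - 3 * t) ^ 2 / (27 * t ^ 2) := by
      field_simp
      ring
    have : 0 ≤ y * (y + 3 * t) * (2 * y - 3 * t) ^ 2 / (27 * t ^ 2) := by positivity
    linarith
  have row : ∀ i, 2 ^ k * (5 / 9 * ∑ j, D i j ^ 2) ≤
      ∑ u : Fin k → Bool, t * |∑ j, D i j * boolSign (u j)| := by
    intro i
    refine le_trans ?_ (Finset.sum_le_sum fun u _ => key _)
    rw [Finset.sum_sub_distrib, ← Finset.mul_sum, ← Finset.sum_div, sum_signed_sq]
    have h4 := sum_signed_pow_four_le k (D i)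
    set r := ∑ j, D i j ^ 2 with hr
    have hr0 : 0 ≤ r := Finset.sum_nonneg fun j _ => sq_nonneg _
    have hrk : r ≤ k := by
      calc r ≤ ∑ _j : Fin k, (1 : ℝ) := Finset.sum_le_sum fun j _ => hD i j
        _ = k := by simp
    have : (∑ u : Fin k → Bool, (∑ j, D i j * boolSign (u j)) ^ 4) / k ≤ 2 ^ k * (3 * r) := by
      rw [div_le_iff₀ hk']
      refine h4.trans ?_
      rw [mul_assoc]
      refine mul_le_mul_of_nonneg_left ?_ (by positivity)
      nlinarith
    linarith
  have total : ∑ _u : Fin k → Bool, 5 / 9 * ∑ i, ∑ j, D i j ^ 2 ≤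
      ∑ u : Fin k → Bool, t * ∑ i, |∑ j, D i j * boolSign (u j)| := by
    have := Finset.sum_le_sum fun i (_ : i ∈ Finset.univ) => row i
    rw [Finset.sum_comm] at this
    simp only [← Finset.mul_sum] at this ⊢
    simpa [mul_left_comm] using this
  obtain ⟨u, -, hu⟩ := Finset.exists_le_of_sum_le Finset.univ_nonempty total
  exact ⟨u, hu⟩

/-- A matrix with entries of absolute value at most `1` and with `R` the sum of the squares of its
entries has a submatrix whose entries sum to at least a constant times `R / √k`, in absolute
value. -/
theorem exists_submatrix_sum_ge {k : ℕ} (hk : 0 < k) (D : Fin k → Fin k → ℝ)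
    (hD : ∀ i j, D i j ^ 2 ≤ 1) :
    ∃ A A' : Finset (Fin k), 5 / 36 * ∑ i, ∑ j, D i j ^ 2 ≤
      √k * |∑ i ∈ A, ∑ j ∈ A', D i j| := by
  obtain ⟨u, hu⟩ := exists_signs_sum_abs_ge hk D hD
  set X : Fin k → ℝ := fun i => ∑ j, D i j * boolSign (u j) with hX
  set A := Finset.univ.filter fun i => 0 ≤ X i
  set C := Finset.univ.filter fun j => u j = true
  have hXi : ∀ i, X i = ∑ j ∈ C, D i j - ∑ j ∈ Cᶜ, D i j := by
    intro i
    simp only [hX]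
    rw [← Finset.sum_add_sum_compl C, sub_eq_add_neg, ← Finset.sum_neg_distrib]
    congr 1
    · refine Finset.sum_congr rfl fun j hj => ?_
      simp [boolSign, (Finset.mem_filter.1 hj).2]
    · refine Finset.sum_congr rfl fun j hj => ?_
      have : u j = false := by simpa [C] using hj
      simp [boolSign, this]
  have habs : ∑ i, |X i| = ∑ i ∈ A, X i - ∑ i ∈ Aᶜ, X i := by
    rw [← Finset.sum_add_sum_compl A, sub_eq_add_neg, ← Finset.sum_neg_distrib]
    congr 1
    · exact Finset.sum_congr rfl fun i hi => abs_of_nonneg (Finset.mem_filter.1 hi).2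
    · refine Finset.sum_congr rfl fun i hi => abs_of_neg ?_
      simpa [A] using hi
  change _ ≤ _ * ∑ i, |X i| at hu
  rw [habs] at hu
  simp only [hXi, Finset.sum_sub_distrib] at hu
  -- The signed sum is split into four blocks, one of which carries a quarter of it: `5/36 =
  -- (5/9)/4`.
  by_contra! hcon
  have h1 := hcon A C
  have h2 := hcon A Cᶜ
  have h3 := hcon Aᶜ C
  have h4 := hcon Aᶜ Cᶜ
  have hs := Real.sqrt_nonneg (k : ℝ)
  have g1 := mul_le_mul_of_nonneg_left (le_abs_self (∑ i ∈ A, ∑ j ∈ C, D i j)) hs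
  have g2 := mul_le_mul_of_nonneg_left (neg_le_abs (∑ i ∈ A, ∑ j ∈ Cᶜ, D i j)) hs
  have g3 := mul_le_mul_of_nonneg_left (neg_le_abs (∑ i ∈ Aᶜ, ∑ j ∈ C, D i j)) hs
  have g4 := mul_le_mul_of_nonneg_left (le_abs_self (∑ i ∈ Aᶜ, ∑ j ∈ Cᶜ, D i j)) hs
  linarith

/-! ### Hubs that make a prescribed cut minimum -/

section MinCut

variable {V : Type*}

theorem cutEdges_compl (G : SimpleGraph V) (S : Set V) : cutEdges G Sᶜ = cutEdges G S := by
  ext e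
  constructor
  · rintro ⟨he, u, hu, v, hv, rfl⟩
    exact ⟨he, v, by simpa using hv, u, hu, Sym2.eq_swap⟩
  · rintro ⟨he, u, hu, v, hv, rfl⟩
    exact ⟨he, v, hv, u, by simpa using hu, Sym2.eq_swap⟩

/-- A cut that separates two vertices has at least as many edges as these have common
neighbours. -/
theorem card_le_ncard_cutEdges [Finite V] {G : SimpleGraph V} {X : Set V} {u v : V} (hu : u ∈ X)
    (hv : v ∉ X) (C : Finset V) (hC : ∀ z ∈ C, G.Adj u z ∧ G.Adj v z) :
    C.card ≤ (cutEdges G X).ncard := by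
  classical
  rw [← Set.ncard_coe_finset]
  -- On the path `u z v`, choose the edge at `z` that crosses the cut.
  refine Set.ncard_le_ncard_of_injOn (fun z => s(z, if z ∈ X then v else u)) ?_ ?_
    (Set.toFinite _)
  · intro z hz
    obtain ⟨h1, h2⟩ := hC z hz
    by_cases hzX : z ∈ X
    · simp only [hzX, if_true]
      exact ⟨h2.symm, z, hzX, v, hv, rfl⟩
    · simp only [hzX, if_false]
      exact ⟨h1.symm, u, hu, z, hzX, Sym2.eq_swap⟩
  · intro z hz z' hz' h
    have n1 := (hC z hz).1.ne
    have n2 := (hC z hz).2.ne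
    have n1' := (hC z' hz').1.ne
    have n2' := (hC z' hz').2.ne
    simp only [Sym2.eq_iff] at h
    rcases h with h | h
    · exact h.1
    · exfalso
      by_cases hzX : z ∈ X <;> by_cases hzX' : z' ∈ X <;> simp_all

/-- If any two vertices on the same side of a cut have at least as many common neighbours
as there are edges in the cut, then the cut is minimum. -/
theorem minCutValue_eq_ncard [Finite V] {G : SimpleGraph V} {Z : Set V} (hZ : Z.Nonempty)
    (hZ' : Zᶜ.Nonempty)
    (h : ∀ u v, u ≠ v → (u ∈ Z ↔ v ∈ Z) → ∃ C : Finset V,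
      (cutEdges G Z).ncard ≤ C.card ∧ ∀ z ∈ C, G.Adj u z ∧ G.Adj v z) :
    minCutValue G = (cutEdges G Z).ncard := by
  refine le_antisymm (Nat.sInf_le ⟨Z, hZ, hZ', rfl⟩) (le_csInf ⟨_, Z, hZ, hZ', rfl⟩ ?_)
  rintro _ ⟨X, ⟨x, hx⟩, ⟨y, hy⟩, rfl⟩
  by_cases hs : ∃ u v, u ∈ X ∧ v ∉ X ∧ (u ∈ Z ↔ v ∈ Z)
  · obtain ⟨u, v, hu, hv, huv⟩ := hs
    obtain ⟨C, hC, hadj⟩ := h u v (fun e => hv (e ▸ hu)) huv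
    exact hC.trans (card_le_ncard_cutEdges hu hv C hadj)
  · push Not at hs
    have hs' : ∀ u v, u ∈ X → v ∉ X → ¬(u ∈ Z ↔ v ∈ Z) := by
      intro u v hu hv
      have := hs u v hu hv
      tauto
    have : X = Z ∨ X = Zᶜ := by
      by_cases hxZ : x ∈ Z
      · left
        ext w
        have h1 := hs' x w hx
        have h2 := hs' w y
        have h3 := hs' x y hx hy
        have h4 : y ∉ X := hy
        tauto
      · right
        ext w
        have h1 := hs' x w hx
        have h2 := hs' w y
        have h3 := hs' x y hx hy
        have h4 : y ∉ X := hy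
        simp only [Set.mem_compl_iff]
        tauto
    rcases this with rfl | rfl
    · exact le_rfl
    · rw [cutEdges_compl]

/-- Hub vertices `hub (true, i)` and `hub (false, i)`: those of the first kind are joined to all
vertices of `Z`, the others to all vertices outside `Z`. -/
def hubGraph {m : ℕ} (Z : Set V) (hub : Bool × Fin m → V) : SimpleGraph V :=
  SimpleGraph.fromRel fun u v => ∃ w i, u = hub (w, i) ∧ (w = true ↔ v ∈ Z)

theorem hubGraph_adj_iff_mem {m : ℕ} {Z : Set V} {hub : Bool × Fin m → V}
    (hhub : ∀ w i, hub (w, i) ∈ Z ↔ w = true) {u v : V} (h : (hubGraph Z hub).Adj u v) :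
    (u ∈ Z ↔ v ∈ Z) := by
  rw [hubGraph, SimpleGraph.fromRel_adj] at h
  obtain ⟨-, ⟨w, i, rfl, h⟩ | ⟨w, i, rfl, h⟩⟩ := h
  · rw [hhub, h]
  · rw [hhub, h]

theorem exists_common_neighbors_hubGraph {m : ℕ} {Z : Set V} {hub : Bool × Fin m → V}
    (hinj : Function.Injective hub) {u v : V} (huv : u ∈ Z ↔ v ∈ Z) :
    ∃ C : Finset V, m - 2 ≤ C.card ∧
      ∀ z ∈ C, (hubGraph Z hub).Adj u z ∧ (hubGraph Z hub).Adj v z := by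
  classical
  set w : Bool := decide (u ∈ Z) with hw
  have hwi : Function.Injective fun i : Fin m => hub (w, i) := fun i j hij => by
    simpa using hinj hij
  -- Since `u` and `v` may be hubs themselves, two hubs can be lost.
  refine ⟨((Finset.univ.image fun i => hub (w, i)).erase u).erase v, ?_, ?_⟩
  · have h1 := Finset.pred_card_le_card_erase (s := Finset.univ.image fun i => hub (w, i)) (a := u)
    have h2 := Finset.pred_card_le_card_erase
      (s := (Finset.univ.image fun i => hub (w, i)).erase u) (a := v)
    rw [Finset.card_image_of_injective _ hwi, Finset.card_univ, Fintype.card_fin] at h1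
    omega
  · intro z hz
    simp only [Finset.mem_erase, Finset.mem_image, Finset.mem_univ, true_and] at hz
    obtain ⟨hzv, hzu, i, rfl⟩ := hz
    simp only [hubGraph, SimpleGraph.fromRel_adj]
    exact ⟨⟨hzu.symm, Or.inr ⟨w, i, rfl, by simp [hw]⟩⟩,
      ⟨hzv.symm, Or.inr ⟨w, i, rfl, by simp [hw, huv]⟩⟩⟩

/-- Adding hubs to a graph with few edges between `Z` and its complement makes `Z` a
minimum cut. -/
theorem minCutValue_sup_hubGraph [Finite V] {m : ℕ} {H : SimpleGraph V} {Z : Set V}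
    {hub : Bool × Fin m → V} (hinj : Function.Injective hub)
    (hhub : ∀ w i, hub (w, i) ∈ Z ↔ w = true) (hm : (cutEdges H Z).ncard + 2 ≤ m) :
    minCutValue (H ⊔ hubGraph Z hub) = (cutEdges H Z).ncard := by
  have hcut : cutEdges (H ⊔ hubGraph Z hub) Z = cutEdges H Z := by
    ext e
    constructor
    · rintro ⟨he, u, hu, v, hv, rfl⟩
      refine ⟨?_, u, hu, v, hv, rfl⟩
      rw [SimpleGraph.mem_edgeSet, SimpleGraph.sup_adj] at he
      rcases he with he | he
      · exact he
      · exact absurd ((hubGraph_adj_iff_mem hhub he).1 hu) hv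
    · rintro ⟨he, u, hu, v, hv, rfl⟩
      exact ⟨Or.inl he, u, hu, v, hv, rfl⟩
  have hpos : 0 < m := by omega
  rw [← hcut]
  refine minCutValue_eq_ncard ⟨hub (true, ⟨0, hpos⟩), by simp [hhub]⟩
    ⟨hub (false, ⟨0, hpos⟩), by simp [hhub]⟩ fun u v _ huv => ?_
  obtain ⟨C, hC, hadj⟩ := exists_common_neighbors_hubGraph hinj huv
  exact ⟨C, by rw [hcut]; omega, fun z hz => ⟨Or.inr (hadj z hz).1, Or.inr (hadj z hz).2⟩⟩

end MinCut

/-! ### Two-fold covers that encode bit strings -/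

section Lift

variable {V : Type*} {B k m : ℕ}

/-- The edges of the two-fold cover, given by the signs `x`, of `B` disjoint copies of the complete
bipartite graph with `k` vertices on both sides. The vertex `(b, i, r, c)` is in copy `b`, on the
side `r`, over vertex `i`. -/
def liftEdge (φ : Fin B × Fin k × Bool × Bool → V) (x : Fin B × Fin k × Fin k → Bool)
    (q : (Fin B × Fin k × Fin k) × Bool) : Sym2 V :=
  s(φ (q.1.1, q.1.2.1, false, q.2), φ (q.1.1, q.1.2.2, true, xor q.2 (x q.1)))

theorem liftEdge_injective {φ : Fin B × Fin k × Bool × Bool → V} (hφ : Function.Injective φ)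
    (x : Fin B × Fin k × Fin k → Bool) : Function.Injective (liftEdge φ x) := by
  rintro ⟨⟨b, i, j⟩, c⟩ ⟨⟨b', i', j'⟩, c'⟩ h
  simp only [liftEdge, Sym2.eq_iff, hφ.eq_iff, Prod.mk.injEq] at h
  grind

/-- The two-fold cover with edges `liftEdge φ x`. -/
def liftGraph (φ : Fin B × Fin k × Bool × Bool → V) (x : Fin B × Fin k × Fin k → Bool) :
    SimpleGraph V :=
  SimpleGraph.fromEdgeSet (Set.range (liftEdge φ x))

theorem edgeSet_liftGraph {φ : Fin B × Fin k × Bool × Bool → V} (hφ : Function.Injective φ)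
    (x : Fin B × Fin k × Fin k → Bool) : (liftGraph φ x).edgeSet = Set.range (liftEdge φ x) := by
  rw [liftGraph, SimpleGraph.edgeSet_fromEdgeSet, sdiff_eq_left, Set.disjoint_left]
  rintro _ ⟨q, rfl⟩ h
  simp [liftEdge, hφ.eq_iff] at h

/-- Inclusion-exclusion: `L` and `R` are the edges with left, respectively right, endpoint in `Z`.
The cut is their symmetric difference, their sizes do not depend on `x`, and their intersection
counts the bits `false`. -/
theorem ncard_cutEdges_liftGraph {φ : Fin B × Fin k × Bool × Bool → V}
    (hφ : Function.Injective φ) (x : Fin B × Fin k × Fin k → Bool) (b : Fin B)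
    (A A' : Finset (Fin k)) {Z : Set V}
    (hZ : ∀ b' i r c, φ (b', i, r, c) ∈ Z ↔ b' = b ∧ c = false ∧ i ∈ bif r then A' else A) :
    (cutEdges (liftGraph φ x) Z).ncard +
      2 * ((A ×ˢ A').filter fun p => x (b, p) = false).card = k * (A.card + A'.card) := by
  classical
  set L : Finset ((Fin B × Fin k × Fin k) × Bool) :=
    (A ×ˢ Finset.univ).image fun p => ((b, p), false) with hL
  set R : Finset ((Fin B × Fin k × Fin k) × Bool) :=
    (Finset.univ ×ˢ A').image fun p => ((b, p), x (b, p)) with hR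
  have memL : ∀ q, q ∈ L ↔ φ (q.1.1, q.1.2.1, false, q.2) ∈ Z := by
    rintro ⟨⟨b', i, j⟩, c⟩
    simp [hL, hZ]
    grind
  have memR : ∀ q, q ∈ R ↔ φ (q.1.1, q.1.2.2, true, xor q.2 (x q.1)) ∈ Z := by
    rintro ⟨⟨b', i, j⟩, c⟩
    simp [hR, hZ]
    grind
  have hcut : cutEdges (liftGraph φ x) Z = liftEdge φ x '' ↑(symmDiff L R) := by
    ext e
    rw [cutEdges, edgeSet_liftGraph hφ]
    simp only [Set.mem_ofPred_eq, Set.mem_image, Finset.mem_coe, Finset.mem_symmDiff, memL, memR]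
    constructor
    · rintro ⟨⟨q, rfl⟩, u, hu, v, hv, h⟩
      refine ⟨q, ?_, rfl⟩
      rw [liftEdge, Sym2.eq_iff] at h
      rcases h with ⟨rfl, rfl⟩ | ⟨rfl, rfl⟩
      · exact Or.inl ⟨hu, hv⟩
      · exact Or.inr ⟨hu, hv⟩
    · rintro ⟨q, h | h, rfl⟩
      · exact ⟨⟨q, rfl⟩, _, h.1, _, h.2, rfl⟩
      · exact ⟨⟨q, rfl⟩, _, h.1, _, h.2, Sym2.eq_swap⟩
  have hint : (L ∩ R).card = ((A ×ˢ A').filter fun p => x (b, p) = false).card := by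
    rw [← Finset.card_image_of_injective (f := fun p => (((b, p), false) :
      (Fin B × Fin k × Fin k) × Bool)) _ (fun p p' h => by simpa using h)]
    congr 1
    ext ⟨⟨b', i, j⟩, c⟩
    simp [hL, hR]
    grind
  have cL : L.card = A.card * k := by
    rw [hL, Finset.card_image_of_injective _ (fun p p' h => by simpa using h)]
    simp
  have cR : R.card = k * A'.card := by
    rw [hR, Finset.card_image_of_injective _ (fun p p' h => by simp at h; exact h.1)]
    simp
  have e1 := Finset.card_sdiff_add_card_inter L R
  have e2 := Finset.card_sdiff_add_card_inter R L
  rw [Finset.inter_comm] at e2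
  have e3 : (symmDiff L R).card = (L \ R).card + (R \ L).card := by
    rw [symmDiff, Finset.sup_eq_union, Finset.card_union_of_disjoint disjoint_sdiff_sdiff]
  rw [hcut, Set.ncard_image_of_injective _ (liftEdge_injective hφ x), Set.ncard_coe_finset, ← hint,
    mul_add, mul_comm k A.card]
  omega

/-- The set with the hubs of the first kind and, in copy `b` and in the layer `false`, the vertices
in `A` and `A'`. -/
def cutSide (ψ : (Fin B × Fin k × Bool × Bool) ⊕ (Bool × Fin m) → V) (b : Fin B)
    (A A' : Finset (Fin k)) : Set V :=
  ψ '' {v | match v with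
    | Sum.inl (b', i, r, c) => b' = b ∧ c = false ∧ i ∈ bif r then A' else A
    | Sum.inr (w, _) => w = true}

/-- The two-fold cover given by `x`, with hubs attached. -/
def queryGraph (ψ : (Fin B × Fin k × Bool × Bool) ⊕ (Bool × Fin m) → V)
    (x : Fin B × Fin k × Fin k → Bool) (b : Fin B) (A A' : Finset (Fin k)) : SimpleGraph V :=
  liftGraph (ψ ∘ Sum.inl) x ⊔ hubGraph (cutSide ψ b A A') (ψ ∘ Sum.inr)

theorem minCutValue_queryGraph [Finite V]
    {ψ : (Fin B × Fin k × Bool × Bool) ⊕ (Bool × Fin m) → V} (hψ : Function.Injective ψ)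
    (x : Fin B × Fin k × Fin k → Bool) (b : Fin B) (A A' : Finset (Fin k))
    (hm : k * (A.card + A'.card) + 2 ≤ m) :
    (minCutValue (queryGraph ψ x b A A') : ℝ) = k * (A.card + A'.card) -
      2 * ∑ i ∈ A, ∑ j ∈ A', if x (b, i, j) = false then (1 : ℝ) else 0 := by
  have h := ncard_cutEdges_liftGraph (hψ.comp Sum.inl_injective) x b A A'
    (Z := cutSide ψ b A A') (by intros; simp [cutSide, hψ.eq_iff])
  rw [queryGraph, minCutValue_sup_hubGraph (hψ.comp Sum.inr_injective)
    (by intros; simp [cutSide, hψ.eq_iff]) (by omega), eq_sub_iff_add_eq]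
  rw [← Finset.sum_product', ← Finset.sum_filter, Finset.sum_const, nsmul_one]
  exact_mod_cast h

/-- The edges of the two-fold cover, as a list. -/
noncomputable def liftStream (ψ : (Fin B × Fin k × Bool × Bool) ⊕ (Bool × Fin m) → V)
    (x : Fin B × Fin k × Fin k → Bool) : List (Sym2 V) :=
  Finset.univ.toList.map (liftEdge (ψ ∘ Sum.inl) x)

/-- The edges at the hubs, as a list. -/
noncomputable def hubStream [Finite V]
    (ψ : (Fin B × Fin k × Bool × Bool) ⊕ (Bool × Fin m) → V) (b : Fin B)
    (A A' : Finset (Fin k)) : List (Sym2 V) :=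
  (hubGraph (cutSide ψ b A A') (ψ ∘ Sum.inr)).edgeSet.toFinite.toFinset.toList

/-- The length does not depend on `x`, so knowing the position when the query begins reveals nothing
about `x`. -/
theorem length_liftStream (ψ : (Fin B × Fin k × Bool × Bool) ⊕ (Bool × Fin m) → V)
    (x : Fin B × Fin k × Fin k → Bool) :
    (liftStream ψ x).length = Fintype.card ((Fin B × Fin k × Fin k) × Bool) := by
  rw [liftStream, List.length_map, Finset.length_toList, Finset.card_univ]

theorem isEdgeStream_queryGraph [Finite V]
    {ψ : (Fin B × Fin k × Bool × Bool) ⊕ (Bool × Fin m) → V} (hψ : Function.Injective ψ)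
    (x : Fin B × Fin k × Fin k → Bool) (b : Fin B) (A A' : Finset (Fin k)) :
    IsEdgeStream (queryGraph ψ x b A A') (liftStream ψ x ++ hubStream ψ b A A') := by
  have hl := hψ.comp Sum.inl_injective
  constructor
  · rw [List.nodup_append']
    refine ⟨(Finset.nodup_toList _).map (liftEdge_injective hl x), Finset.nodup_toList _, ?_⟩
    intro e h1 h2
    simp only [liftStream, hubStream, List.mem_map, Finset.mem_toList, Finset.mem_univ, true_and,
      Set.Finite.mem_toFinset] at h1 h2
    obtain ⟨q, rfl⟩ := h1
    rw [liftEdge, SimpleGraph.mem_edgeSet, hubGraph, SimpleGraph.fromRel_adj] at h2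
    simp [hψ.eq_iff] at h2
  · intro e
    rw [queryGraph, SimpleGraph.edgeSet_sup, edgeSet_liftGraph hl]
    simp [liftStream, hubStream]

end Lift

/-! ### From streaming algorithms to messages -/

namespace StreamingAlgorithm

theorem process_append {α β : Type*} {s : ℕ} (A : StreamingAlgorithm α β s) (l l' : List α)
    (t : ℕ) (m : Fin s → Bool) :
    A.process t m (l ++ l') = A.process (t + l.length) (A.process t m l) l' := by
  induction l generalizing t m with
  | nil => rfl
  | cons a l ih =>
    simp only [List.cons_append, process, ih, List.length_cons]
    congr 1
    omega

end StreamingAlgorithm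

theorem exists_injective_copies_sum_hubs {n B k m : ℕ} (h : 4 * (k * B) + 2 * m ≤ n) :
    ∃ ψ : (Fin B × Fin k × Bool × Bool) ⊕ (Bool × Fin m) → Fin n, Function.Injective ψ := by
  obtain ⟨ψ⟩ := Function.Embedding.nonempty_of_card_le
    (α := (Fin B × Fin k × Bool × Bool) ⊕ (Bool × Fin m)) (β := Fin n) (by
      simp only [Fintype.card_sum, Fintype.card_prod, Fintype.card_fin, Fintype.card_bool]
      linarith [mul_comm k B, mul_assoc B k (2 * 2)])
  exact ⟨ψ, ψ.injective⟩

theorem run_liftStream_append {n s B k m : ℕ} (A : StreamingAlgorithm (Sym2 (Fin n)) ℝ s)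
    (ψ : (Fin B × Fin k × Bool × Bool) ⊕ (Bool × Fin m) → Fin n)
    (x : Fin B × Fin k × Fin k → Bool) (l : List (Sym2 (Fin n))) :
    A.run (liftStream ψ x ++ l) =
      A.output (A.process (Fintype.card ((Fin B × Fin k × Fin k) × Bool))
        (A.process 0 A.init (liftStream ψ x)) l) := by
  rw [StreamingAlgorithm.run, StreamingAlgorithm.process_append, length_liftStream, zero_add]

theorem bits_le_of_randomizedApproximates {n s B k : ℕ} {ε : ℝ}
    (hn : 4 * (k * B) + 2 * (2 * k + 2) ≤ n) (hε : (2 * k - 1) * ε < 1) {Ω : Type*}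
    [MeasurableSpace Ω] (P : Measure Ω) [IsProbabilityMeasure P]
    (A : Ω → StreamingAlgorithm (Sym2 (Fin n)) ℝ s)
    (h : RandomizedApproximatesMinCut P ε (2 / 3) A) : B * (k * k) ≤ 13 * s := by
  obtain ⟨ψ, hψ⟩ := exists_injective_copies_sum_hubs hn
  let E : (Fin B × Fin k × Fin k → Bool) → Fin B × Fin k × Fin k → Set Ω := fun x p =>
    {ω | IsApprox ε ((A ω).run (liftStream ψ x ++ hubStream ψ p.1 {p.2.1} {p.2.2}))
      (minCutValue (queryGraph ψ x p.1 {p.2.1} {p.2.2}))}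
  let f : Ω → (Fin B × Fin k × Fin k → Bool) → (Fin s → Bool) := fun ω x =>
    (A ω).process 0 (A ω).init (liftStream ψ x)
  -- The threshold is the least valid answer for value `2k`; valid answers for `2k - 2` lie below it
  -- by `hε`.
  let g : Ω → (Fin s → Bool) → Fin B × Fin k × Fin k → Bool := fun ω M p =>
    decide ((1 - ε) * (2 * k) ≤ (A ω).output ((A ω).process
      (Fintype.card ((Fin B × Fin k × Fin k) × Bool)) M (hubStream ψ p.1 {p.2.1} {p.2.2})))
  have hE : ∀ x p ω, ω ∈ E x p → g ω (f ω x) p = x p := by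
    intro x p ω hω
    simp only [E, Set.mem_ofPred_eq, run_liftStream_append] at hω
    rw [minCutValue_queryGraph hψ _ _ _ _ (by simp; omega)] at hω
    simp only [Finset.sum_singleton, Finset.card_singleton, Prod.mk.eta] at hω
    obtain ⟨h1, h2⟩ := hω
    cases hx : x p with
    | false =>
      rw [decide_eq_false_iff_not, not_le]
      refine lt_of_le_of_lt h2 ?_
      norm_num [hx]
      linarith
    | true =>
      rw [decide_eq_true_eq]
      refine le_trans (le_of_eq ?_) h1
      norm_num [hx]
      left; ring
  have hmeas : ∀ x p, MeasurableSet (E x p) := by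
    intro x p
    have hm := (h _ _ (isEdgeStream_queryGraph hψ x p.1 {p.2.1} {p.2.2})).1
    exact (measurableSet_le measurable_const hm).inter (measurableSet_le hm measurable_const)
  have hprob : ∀ x p, 2 / 3 ≤ P.real (E x p) := fun x p =>
    (h _ _ (isEdgeStream_queryGraph hψ x p.1 {p.2.1} {p.2.2})).2
  have hint : ∀ x p, Integrable ((E x p).indicator (1 : Ω → ℝ)) P := fun x p =>
    (integrable_const 1).indicator (hmeas x p)
  -- Averaging fixes one seed that recovers two thirds of the bits on average over `x`.
  obtain ⟨ω, hω⟩ := exists_integral_le (μ := P)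
    (f := fun ω => ∑ x, ∑ p, (E x p).indicator (1 : Ω → ℝ) ω)
    (integrable_finsetSum _ fun x _ => integrable_finsetSum _ fun p _ => hint x p)
  rw [integral_finsetSum _ fun x _ => integrable_finsetSum _ fun p _ => hint x p] at hω
  simp_rw [integral_finsetSum _ fun p _ => hint _ p, integral_indicator_one (hmeas _ _)] at hω
  have hcard : Fintype.card (Fin B × Fin k × Fin k) = B * (k * k) := by simp
  rw [← hcard]
  refine card_le_of_agree (f ω) (g ω) ?_
  calc (2 / 3 * Fintype.card (Fin B × Fin k × Fin k) *
          2 ^ Fintype.card (Fin B × Fin k × Fin k) : ℝ)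
      = ∑ _x : Fin B × Fin k × Fin k → Bool, ∑ _p : Fin B × Fin k × Fin k, (2 / 3 : ℝ) := by
        simp only [Finset.sum_const, Finset.card_univ, Fintype.card_fun, Fintype.card_bool,
          nsmul_eq_mul]
        push_cast
        ring
    _ ≤ ∑ x, ∑ p, P.real (E x p) :=
        Finset.sum_le_sum fun x _ => Finset.sum_le_sum fun p _ => hprob x p
    _ ≤ _ := hω
    _ ≤ _ := by
        refine Finset.sum_le_sum fun x _ => ?_
        rw [Finset.card_filter]
        push_cast
        refine Finset.sum_le_sum fun p _ => ?_
        by_cases hp : ω ∈ E x p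
        · simp [hp, hE x p ω hp]
        · simp only [Set.indicator_of_notMem hp]
          split_ifs <;> norm_num

/-- Equal memory forces one common answer to every query, so the two cut values are close for all
`S, S'`. Disagreement in a third of some copy would give a gap of at least `5/108 * k²/√k` in the
counts, while at most `2 ε k² ≤ 1/25 * k²/√k` is tolerated. -/
theorem two_thirds_agree_of_process_eq {n s B k : ℕ} {ε : ℝ} (hk : 0 < k)
    (hε : ε * √k ≤ 1 / 50) (hε0 : 0 ≤ ε) (A : StreamingAlgorithm (Sym2 (Fin n)) ℝ s)
    (h : ApproximatesMinCut ε A)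
    {ψ : (Fin B × Fin k × Bool × Bool) ⊕ (Bool × Fin (2 * k * k + 2)) → Fin n}
    (hψ : Function.Injective ψ) {x y : Fin B × Fin k × Fin k → Bool}
    (hxy : A.process 0 A.init (liftStream ψ x) = A.process 0 A.init (liftStream ψ y)) :
    (2 / 3 * Fintype.card (Fin B × Fin k × Fin k) : ℝ) ≤
      (Finset.univ.filter fun p => y p = x p).card := by
  by_contra! hlt
  have hk' : (0 : ℝ) < k := by exact_mod_cast hk
  obtain ⟨b, hb⟩ : ∃ b : Fin B, (k * k / 3 : ℝ) ≤
      ∑ i, ∑ j, if y (b, i, j) = x (b, i, j) then (0 : ℝ) else 1 := by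
    by_contra! hcon
    have h1 := Finset.sum_le_sum fun b (_ : b ∈ Finset.univ) => (hcon b).le
    have h2 : (∑ b : Fin B, ∑ i, ∑ j, if y (b, i, j) = x (b, i, j) then (0 : ℝ) else 1) +
        (Finset.univ.filter fun p => y p = x p).card = B * (k * k) := by
      rw [Finset.card_filter]
      push_cast
      simp only [Fintype.sum_prod_type, ← Finset.sum_add_distrib]
      rw [Finset.sum_congr rfl fun b _ => Finset.sum_congr rfl fun i _ =>
        Finset.sum_congr rfl fun j _ =>
          show _ = (1 : ℝ) by by_cases e : y (b, i, j) = x (b, i, j) <;> simp [e]]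
      simp
    simp only [Finset.sum_const, Finset.card_univ, Fintype.card_fin, nsmul_eq_mul,
      Fintype.card_prod] at h1 hlt
    push_cast at hlt
    linarith
  let D : Fin k → Fin k → ℝ := fun i j => (if x (b, i, j) = false then (1 : ℝ) else 0) -
    if y (b, i, j) = false then (1 : ℝ) else 0
  have hD : ∀ i j, D i j ^ 2 = if y (b, i, j) = x (b, i, j) then (0 : ℝ) else 1 := by
    intro i j
    cases hx : x (b, i, j) <;> cases hy : y (b, i, j) <;> simp [D, hx, hy]
  obtain ⟨S, S', hS⟩ := exists_submatrix_sum_ge hk D fun i j => by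
    rw [hD]
    split_ifs <;> norm_num
  simp only [hD] at hS
  have c1 : S.card ≤ k := by simpa using S.card_le_univ
  have c2 : S'.card ≤ k := by simpa using S'.card_le_univ
  have hm : k * (S.card + S'.card) + 2 ≤ 2 * k * k + 2 := by nlinarith
  have hvx := minCutValue_queryGraph hψ x b S S' hm
  have hvy := minCutValue_queryGraph hψ y b S S' hm
  have hx := h _ _ (isEdgeStream_queryGraph hψ x b S S')
  have hy := h _ _ (isEdgeStream_queryGraph hψ y b S S')
  rw [run_liftStream_append] at hx hy
  rw [hxy] at hx
  have hdiff : (minCutValue (queryGraph ψ y b S S') : ℝ) - minCutValue (queryGraph ψ x b S S') =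
      2 * ∑ i ∈ S, ∑ j ∈ S', D i j := by
    rw [hvx, hvy]
    simp only [D, Finset.sum_sub_distrib]
    ring
  have nonneg : ∀ z : Fin B × Fin k × Fin k → Bool,
      0 ≤ ∑ i ∈ S, ∑ j ∈ S', if z (b, i, j) = false then (1 : ℝ) else 0 := fun z =>
    Finset.sum_nonneg fun i _ => Finset.sum_nonneg fun j _ => by split_ifs <;> norm_num
  have hm' : (k * (S.card + S'.card) : ℝ) ≤ 2 * k * k := by
    exact_mod_cast Nat.le_of_add_le_add_right hm
  have hbound : |∑ i ∈ S, ∑ j ∈ S', D i j| ≤ ε * (2 * k * k) := by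
    have g : ε * (minCutValue (queryGraph ψ x b S S') + minCutValue (queryGraph ψ y b S S')) ≤
        ε * (4 * k * k) :=
      mul_le_mul_of_nonneg_left (by linarith [nonneg x, nonneg y]) hε0
    obtain ⟨hx1, hx2⟩ := hx
    obtain ⟨hy1, hy2⟩ := hy
    rw [abs_le]
    constructor <;> linarith
  have g1 := mul_le_mul_of_nonneg_left hbound (Real.sqrt_nonneg (k : ℝ))
  have g2 := mul_le_mul_of_nonneg_right hε (by positivity : (0 : ℝ) ≤ 2 * k * k)
  have : (0 : ℝ) < k * k := by positivity
  linarith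

theorem bits_le_of_approximates {n s B k : ℕ} {ε : ℝ} (hk : 0 < k)
    (hn : 4 * (k * B) + 2 * (2 * k * k + 2) ≤ n) (hε0 : 0 ≤ ε) (hε : ε * √k ≤ 1 / 50)
    (A : StreamingAlgorithm (Sym2 (Fin n)) ℝ s) (h : ApproximatesMinCut ε A) :
    B * (k * k) ≤ 13 * s := by
  obtain ⟨ψ, hψ⟩ := exists_injective_copies_sum_hubs hn
  let f : (Fin B × Fin k × Fin k → Bool) → (Fin s → Bool) := fun x =>
    A.process 0 A.init (liftStream ψ x)
  have hcard : Fintype.card (Fin B × Fin k × Fin k) = B * (k * k) := by simp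
  rw [← hcard]
  refine card_le_of_agree f (Function.invFun f) ?_
  have key : ∀ x, (2 / 3 * Fintype.card (Fin B × Fin k × Fin k) : ℝ) ≤
      (Finset.univ.filter fun p => Function.invFun f (f x) p = x p).card := fun x =>
    two_thirds_agree_of_process_eq hk hε hε0 A h hψ (Function.invFun_eq (f := f) ⟨x, rfl⟩).symm
  refine le_trans (le_of_eq ?_) (Finset.sum_le_sum fun x _ => key x)
  simp only [Finset.sum_const, Finset.card_univ, Fintype.card_fun, Fintype.card_bool,
    nsmul_eq_mul]
  push_cast
  ring

/-! ### Zero bits do not suffice -/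

theorem minCutValue_bot {V : Type*} [Nontrivial V] : minCutValue (⊥ : SimpleGraph V) = 0 := by
  obtain ⟨u, v, huv⟩ := exists_pair_ne V
  refine Nat.sInf_eq_zero.2 (Or.inl ⟨{u}, ⟨u, rfl⟩, ⟨v, huv.symm⟩, ?_⟩)
  simp [cutEdges]

theorem minCutValue_top_pos {V : Type*} [Finite V] [Nontrivial V] :
    0 < minCutValue (⊤ : SimpleGraph V) := by
  obtain ⟨u, v, huv⟩ := exists_pair_ne V
  obtain ⟨S, ⟨a, ha⟩, ⟨b, hb⟩, hS⟩ := Nat.sInf_mem (s := {k | ∃ S : Set V, S.Nonempty ∧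
    Sᶜ.Nonempty ∧ (cutEdges (⊤ : SimpleGraph V) S).ncard = k})
    ⟨_, {u}, ⟨u, rfl⟩, ⟨v, huv.symm⟩, rfl⟩
  rw [minCutValue, ← hS, Set.ncard_pos]
  refine ⟨s(a, b), ?_, a, ha, b, hb, rfl⟩
  intro h
  have hab : a = b := h
  exact hb (hab ▸ ha)

/-- Without memory the output ignores the stream, yet the empty graph needs an output at most `0`
and the complete graph a positive one. These disjoint events cannot both have probability `2/3`. -/
theorem pos_bits_of_randomizedApproximates {n s : ℕ} {ε : ℝ} (hn : 2 ≤ n) (hε : ε < 1)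
    {Ω : Type*} [MeasurableSpace Ω] (P : Measure Ω) [IsProbabilityMeasure P]
    (A : Ω → StreamingAlgorithm (Sym2 (Fin n)) ℝ s)
    (h : RandomizedApproximatesMinCut P ε (2 / 3) A) : 0 < s := by
  by_contra! hs
  obtain rfl : s = 0 := by omega
  have : Nontrivial (Fin n) := Fin.nontrivial_iff_two_le.2 hn
  have h0 := h ⊥ [] ⟨List.nodup_nil, by simp⟩
  have h1 := h ⊤ (⊤ : SimpleGraph (Fin n)).edgeSet.toFinite.toFinset.toList
    ⟨Finset.nodup_toList _, by simp⟩
  have hrun : ∀ ω l, (A ω).run l = (A ω).run [] := fun ω l =>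
    congrArg (A ω).output (Subsingleton.elim _ _)
  simp only [hrun, minCutValue_bot] at h0 h1
  have hpos : (0 : ℝ) < minCutValue (⊤ : SimpleGraph (Fin n)) := by
    exact_mod_cast minCutValue_top_pos
  have hdisj : Disjoint {ω | IsApprox ε ((A ω).run []) ((0 : ℕ) : ℝ)}
      {ω | IsApprox ε ((A ω).run []) (minCutValue (⊤ : SimpleGraph (Fin n)))} := by
    rw [Set.disjoint_left]
    rintro ω ⟨-, h2⟩ ⟨h3, -⟩
    have := mul_pos (sub_pos.2 hε) hpos
    norm_num at h2
    linarith
  have hmeas : MeasurableSet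
      {ω | IsApprox ε ((A ω).run []) (minCutValue (⊤ : SimpleGraph (Fin n)))} :=
    (measurableSet_le measurable_const h0.1).inter (measurableSet_le h0.1 measurable_const)
  have h2 : (2 / 3 + 2 / 3 : ℝ) ≤ 1 := by
    refine (add_le_add h0.2 h1.2).trans ?_
    rw [← measureReal_union hdisj hmeas]
    exact measureReal_le_one
  norm_num at h2

/-! ### Choice of parameters -/

/-- Copies with `4 * k` vertices each fill `n` vertices, except for `r` of them and a remainder below
`4 * k`. -/
theorem exists_copies {n k r : ℕ} (hk : 0 < k) (h : r ≤ n) :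
    ∃ B : ℕ, 4 * (k * B) + r ≤ n ∧ (n : ℝ) ≤ 4 * (k * B) + r + 4 * k := by
  refine ⟨(n - r) / (4 * k), ?_, ?_⟩
  · have := Nat.mul_div_le (n - r) (4 * k)
    rw [mul_assoc] at this
    omega
  · have := Nat.lt_mul_div_succ (n - r) (by omega : 0 < 4 * k)
    rw [mul_add, mul_assoc] at this
    have h2 : n ≤ 4 * (k * ((n - r) / (4 * k))) + r + 4 * k := by omega
    exact_mod_cast h2

theorem randomized_bits_ge {n s : ℕ} {ε : ℝ} (hn : 2 ≤ n) (hnε : 1 / (n : ℝ) < ε) (hε : ε < 1)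
    {Ω : Type*} [MeasurableSpace Ω] (P : Measure Ω) [IsProbabilityMeasure P]
    (A : Ω → StreamingAlgorithm (Sym2 (Fin n)) ℝ s)
    (h : RandomizedApproximatesMinCut P ε (2 / 3) A) : 1 / 100000 * (n / ε) ≤ s := by
  have hn0 : (0 : ℝ) < n := by exact_mod_cast (by omega : 0 < n)
  have hε0 : 0 < ε := lt_trans (by positivity) hnε
  have hinv : 1 / ε < n := by
    rw [div_lt_iff₀ hε0]
    rw [div_lt_iff₀ hn0] at hnε
    linarith
  rcases lt_or_ge n 16 with hn16 | hn16
  -- For small `n`, `n/ε` is bounded, so one bit is enough.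
  · have hs : (1 : ℝ) ≤ s := by exact_mod_cast pos_bits_of_randomizedApproximates hn hε P A h
    have hn16' : (n : ℝ) ≤ 16 := by exact_mod_cast hn16.le
    rw [show (n : ℝ) / ε = n * (1 / ε) by ring]
    have : 0 < 1 / ε := by positivity
    nlinarith
  have hn16' : (16 : ℝ) ≤ n := by exact_mod_cast hn16
  set k := ⌈1 / ε / 64⌉₊ with hk
  have hk0 : 0 < k := Nat.ceil_pos.2 (by positivity)
  have hk1 : 1 / ε / 64 ≤ k := Nat.le_ceil _
  have hk2 : (k : ℝ) < 1 / ε / 64 + 1 := Nat.ceil_lt_add_one (by positivity)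
  have hkε : (2 * k - 1) * ε < 1 := by
    -- For large `ε` rounding up gives `k = 1`, and the condition is just `ε < 1`.
    rcases le_or_gt (1 / 64) ε with h64 | h64
    · have : k = 1 := by
        refine le_antisymm (Nat.ceil_le.2 ?_) hk0
        rw [div_div, div_le_iff₀ (by positivity)]
        norm_num
        linarith
      rw [this]
      norm_num
      exact hε
    · have := mul_lt_mul_of_pos_right hk2 hε0
      have e : (1 / ε / 64 + 1) * ε = 1 / 64 + ε := by field_simp
      linarith
  obtain ⟨B, hB1, hB2⟩ := exists_copies (n := n) (r := 2 * (2 * k + 2)) hk0 (by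
    have : (2 * (2 * k + 2) : ℝ) ≤ n := by linarith
    exact_mod_cast this)
  have hmain := bits_le_of_randomizedApproximates hB1 hkε P A h
  have hmain' : (B * (k * k) : ℝ) ≤ 13 * s := by exact_mod_cast hmain
  push_cast at hB2
  have hB3 : (n : ℝ) / 32 ≤ k * B := by linarith
  have : (n : ℝ) / 32 * (1 / ε / 64) ≤ k * B * k :=
    mul_le_mul hB3 hk1 (by positivity) (by positivity)
  have e : (n : ℝ) / 32 * (1 / ε / 64) = n / ε / 2048 := by ring
  have : 0 ≤ (n : ℝ) / ε := by positivity
  linarith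

theorem deterministic_bits_ge {n s : ℕ} {ε : ℝ} (hn : 2 ≤ n)
    (hnε : 1 / (n : ℝ) ^ (1 / 4 : ℝ) ≤ ε) (hε : ε < 1)
    (A : StreamingAlgorithm (Sym2 (Fin n)) ℝ s) (h : ApproximatesMinCut ε A) :
    1 / 5000000 * (n / ε ^ 2) ≤ s := by
  have hn1 : (1 : ℝ) < n := by exact_mod_cast hn
  have hn0 : (0 : ℝ) < n := by linarith
  have hε0 : 0 < ε := lt_of_lt_of_le (by positivity) hnε
  rcases lt_or_ge (1 / 50) ε with h50 | h50
  -- For `ε > 1/50` the two bounds agree up to a constant, and a deterministic algorithm is a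
  -- randomized one with a trivial seed.
  · have hrand : RandomizedApproximatesMinCut (Measure.dirac ()) ε (2 / 3) fun _ => A := by
      intro G l hl
      refine ⟨measurable_const, ?_⟩
      have := h G l hl
      simp only [this]
      norm_num
    have hlt : 1 / (n : ℝ) < ε := by
      refine lt_of_lt_of_le ?_ hnε
      refine one_div_lt_one_div_of_lt (by positivity) ?_
      calc (n : ℝ) ^ (1 / 4 : ℝ) < (n : ℝ) ^ (1 : ℝ) :=
            Real.rpow_lt_rpow_of_exponent_lt hn1 (by norm_num)
        _ = n := Real.rpow_one _
    refine le_trans ?_ (randomized_bits_ge hn hlt hε _ _ hrand)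
    rw [show (n : ℝ) / ε ^ 2 = n / ε * (1 / ε) by field_simp]
    have h1 : 1 / ε ≤ 50 := by
      rw [div_le_iff₀ hε0]
      linarith
    have := mul_le_mul_of_nonneg_left h1 (by positivity : 0 ≤ (n : ℝ) / ε)
    linarith
  have hn4 : (1 / ε ^ 2) ^ 2 ≤ n := by
    have h1 : 1 / ε ≤ (n : ℝ) ^ (1 / 4 : ℝ) := by
      rw [div_le_iff₀ (by positivity)] at hnε ⊢
      linarith
    calc (1 / ε ^ 2) ^ 2 = (1 / ε) ^ 4 := by ring
      _ ≤ ((n : ℝ) ^ (1 / 4 : ℝ)) ^ 4 := pow_le_pow_left₀ (by positivity) h1 4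
      _ = n := by
        rw [← Real.rpow_natCast, ← Real.rpow_mul hn0.le]
        norm_num
  set q := 1 / ε ^ 2 with hq
  have hq2500 : 2500 ≤ q := by
    rw [hq, le_div_iff₀ (by positivity)]
    nlinarith
  set k := ⌊q / 2500⌋₊ with hk
  have hk0 : 0 < k := Nat.floor_pos.2 (by linarith)
  have hk1 : (1 : ℝ) ≤ k := by exact_mod_cast hk0
  have hk2 : (k : ℝ) ≤ q / 2500 := Nat.floor_le (by positivity)
  have hk3 : q / 2500 < k + 1 := Nat.lt_floor_add_one _
  have hsqrt : ε * √k ≤ 1 / 50 := by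
    have : √(k : ℝ) ≤ 1 / (50 * ε) := by
      refine Real.sqrt_le_iff.2 ⟨by positivity, hk2.trans (le_of_eq ?_)⟩
      rw [hq]
      field_simp
      norm_num
    calc ε * √k ≤ ε * (1 / (50 * ε)) := mul_le_mul_of_nonneg_left this hε0.le
      _ = 1 / 50 := by field_simp
  have hkk : (k * k : ℝ) ≤ n / 100 := by
    have := mul_le_mul hk2 hk2 (by positivity) (by positivity)
    nlinarith
  have hkn : (k : ℝ) ≤ n / 100 := by nlinarith
  have hn100 : (100 : ℝ) ≤ n := by nlinarith
  obtain ⟨B, hB1, hB2⟩ := exists_copies (n := n) (r := 2 * (2 * k * k + 2)) hk0 (by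
    have : (2 * (2 * k * k + 2) : ℝ) ≤ n := by linarith
    exact_mod_cast this)
  have hmain := bits_le_of_approximates hk0 hB1 hε0.le hsqrt A h
  have hmain' : (B * (k * k) : ℝ) ≤ 13 * s := by exact_mod_cast hmain
  push_cast at hB2
  have hB3 : (n : ℝ) / 5 ≤ k * B := by linarith
  have : (n : ℝ) / 5 * (q / 5000) ≤ k * B * k :=
    mul_le_mul hB3 (by linarith) (by positivity) (by positivity)
  rw [show (n : ℝ) / ε ^ 2 = n * q by rw [hq]; ring]
  have : 0 ≤ (n : ℝ) * q := by positivity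
  linarith

theorem mainTheorem4 :
    (∃ c : ℝ, 0 < c ∧
      ∀ (n s : ℕ) (ε : ℝ), 2 ≤ n → 1 / (n : ℝ) < ε → ε < 1 →
        ∀ (Ω : Type*) [MeasurableSpace Ω] (P : Measure Ω) [IsProbabilityMeasure P]
          (A : Ω → StreamingAlgorithm (Sym2 (Fin n)) ℝ s),
          RandomizedApproximatesMinCut P ε (2 / 3) A → c * (n / ε) ≤ s) ∧
    (∃ c : ℝ, 0 < c ∧
      ∀ (n s : ℕ) (ε : ℝ), 2 ≤ n → 1 / (n : ℝ) ^ (1 / 4 : ℝ) ≤ ε → ε < 1 →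
        ∀ A : StreamingAlgorithm (Sym2 (Fin n)) ℝ s,
          ApproximatesMinCut ε A → c * (n / ε ^ 2) ≤ s) :=
  ⟨⟨1 / 100000, by norm_num, fun _ _ _ hn hnε hε _ _ P _ A h =>
      randomized_bits_ge hn hnε hε P A h⟩,
    ⟨1 / 5000000, by norm_num, fun _ _ _ hn hnε hε A h =>
      deterministic_bits_ge hn hnε hε A h⟩⟩
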